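/- **Bipartite time-energy uncertainty relation.** Let $A,B,E$ be finite-dimensional quantum systems, $\mathcal N_{A\to B}$ a quantum channel (completely positive and trace preserving), and $\widehat{\mathcal N}_{A\to E}$ a complementary channel: for some isometry $V:A\to B\otimes E$, $\mathcal N(X)=\mathrm{tr}_E(VXV^\dagger)$ and $\widehat{\mathcal N}(X)=\mathrm{tr}_B(VXV^\dagger)$ for all operators $X$ on $A$. Let $(t,\eta)\mapsto|\psi(t,\eta)\rangle$ be a two-parameter family of unit vectors of $A$; write $\psi(t,\eta)=|\psi(t,\eta)\rangle\langle\psi(t,\eta)|$ and $\psi=\psi(t_0,\eta_0)$. Let $H$ be a Hermitian operator (the Hamiltonian at $t_0$) with $\langle H\rangle_\psi=\eta_0$ and non-zero variance $\langle H^2\rangle_\psi-\langle H\rangle_\psi^2\neq0$. Suppose that at the point $(t_0,\eta_0)$ $$\partial_t\psi=-i[H,\psi],\qquad \partial_\eta\psi=i[T,\psi],$$ where $T$ is an optimal local sensing observable for $t$: $T$ minimises $\mathrm{tr}(\psi\,(T'-t_0)^2)$ among the Hermitian operators $T'$ with $\mathrm{tr}(\psi T')=t_0$ and $\mathrm{tr}(T'\,\partial_t\psi)=1$.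 For a positive semidefinite operator $\rho$ and a Hermitian operator $D$, the quantum Fisher information is $F(\rho;D)=\mathrm{tr}(\rho R^2)$, where $R$ is any Hermitian solution of $\tfrac12(\rho R+R\rho)=D$ (it is defined if there is one, and does not depend on the choice of $R$). Put $\rho_B(t)=\mathcal N(\psi(t,\eta_0))$, $\rho_E(\eta)=\widehat{\mathcal N}(\psi(t_0,\eta))$, and, at $(t_0,\eta_0)$, $$F_{\mathrm{Alice}}(t)=F(\psi;\partial_t\psi),\quad F_{\mathrm{Bob}}(t)=F(\rho_B;\partial_t\rho_B),\quad F_{\mathrm{Alice}}(\eta)=F(\psi;\partial_\eta\psi),\quad F_{\mathrm{Eve}}(\eta)=F(\rho_E;\partial_\eta\rho_E).$$ Suppose that the rank of $\rho_B(t)$ does not change at $t_0$, in the following sense: for functions $p_k$, $k=1,\dots,\dim B$, which near $t_0$ list the eigenvalues of $\rho_B(t)$ with multiplicity, every $p_k$ with $p_k(t_0)=0$ is twice differentiable at $t_0$ and $\partial_t^2p_k(t_0)=0$. Then the four Fisher informations are defined, $F_{\mathrm{Alice}}(t)>0$ and $F_{\mathrm{Alice}}(\eta)>0$, and $$\frac{F_{\mathrm{Bob}}(t)}{F_{\mathrm{Alice}}(t)}+\frac{F_{\mathrm{Eve}}(\eta)}{F_{\mathrm{Alice}}(\eta)}=1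 .$$ -/

import Mathlib

open scoped Matrix Topology ComplexOrder

namespace BipartiteUncertainty

/-! ### State vectors, observables -/

/-- The density operator `|v⟩⟨v|` of a vector `v`. -/
def pureState {a : Type*} (v : a → ℂ) : Matrix a a ℂ :=
  Matrix.vecMulVec v (star v)

/-- The expectation value `tr (ρ M)` of an observable `M` in the state `ρ`. -/
noncomputable def expectation {a : Type*} [Fintype a] (ρ M : Matrix a a ℂ) : ℝ :=
  ((ρ * M).trace).re

/-- The variance `⟨M ^ 2⟩ - ⟨M⟩ ^ 2` of an observable `M` in the state `ρ`. -/
noncomputable def variance {a : Type*} [Fintype a] [DecidableEq a] (ρ M : Matrix a a ℂ) : ℝ :=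
  expectation ρ (M ^ 2) - expectation ρ M ^ 2

/-! ### Quantum Fisher information -/

/-- `R` is a symmetric logarithmic derivative of `ρ` in the direction `D`:
a Hermitian solution of `(ρ R + R ρ) / 2 = D`. -/
def IsSLD {a : Type*} [Fintype a] (ρ D R : Matrix a a ℂ) : Prop :=
  R.IsHermitian ∧ (1 / 2 : ℂ) • (ρ * R + R * ρ) = D

/-- The quantum Fisher information of `ρ` in the direction `D` is defined and equal to `F`:
there is a symmetric logarithmic derivative, and `F = tr (ρ R ^ 2)` for every one of them. -/
def HasFisherInfo {a : Type*} [Fintype a] [DecidableEq a] (ρ D : Matrix a a ℂ) (F : ℝ) : Prop :=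
  (∃ R, IsSLD ρ D R) ∧ ∀ R, IsSLD ρ D R → (ρ * R ^ 2).trace = (F : ℂ)

/-- The one-parameter family `s ↦ ρ s` of states is differentiable at `s₀` and has quantum
Fisher information `F` there. -/
def HasFisherInfoAt {a : Type*} [Fintype a] [DecidableEq a]
    (ρ : ℝ → Matrix a a ℂ) (s₀ : ℝ) (F : ℝ) : Prop :=
  ∃ D, HasDerivAt ρ D s₀ ∧ HasFisherInfo (ρ s₀) D F

/-! ### Local sensing observables -/

/-- `T` reveals, to first order, the value of the parameter around `s₀` of a family of states
that has the value `ρ` and the derivative `D` at `s₀`. -/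
def IsLocalSensing {a : Type*} [Fintype a] (ρ D : Matrix a a ℂ) (s₀ : ℝ)
    (T : Matrix a a ℂ) : Prop :=
  T.IsHermitian ∧ (ρ * T).trace = (s₀ : ℂ) ∧ (T * D).trace = 1

/-- The mean square error `⟨(T - s₀) ^ 2⟩` in the state `ρ`. -/
noncomputable def meanSquareError {a : Type*} [Fintype a] [DecidableEq a] (ρ : Matrix a a ℂ)
    (s₀ : ℝ) (T : Matrix a a ℂ) : ℝ :=
  expectation ρ ((T - (s₀ : ℂ) • (1 : Matrix a a ℂ)) ^ 2)

/-- An optimal local sensing observable: one of least mean square error. -/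
def IsOptimalLocalSensing {a : Type*} [Fintype a] [DecidableEq a] (ρ D : Matrix a a ℂ) (s₀ : ℝ)
    (T : Matrix a a ℂ) : Prop :=
  IsLocalSensing ρ D s₀ T ∧
    ∀ T', IsLocalSensing ρ D s₀ T' → meanSquareError ρ s₀ T ≤ meanSquareError ρ s₀ T'

/-! ### Channels and complementary channels -/

/-- The map `id ⊗ N` on operators on `ℂⁿ ⊗ A`. -/
def ampliation {a b : Type*} (n : ℕ) (N : Matrix a a ℂ →ₗ[ℂ] Matrix b b ℂ)
    (X : Matrix (Fin n × a) (Fin n × a) ℂ) : Matrix (Fin n × b) (Fin n × b) ℂ :=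
  Matrix.of fun x y => N (Matrix.of fun p q => X (x.1, p) (y.1, q)) x.2 y.2

/-- A quantum channel: a completely positive, trace-preserving linear map. -/
structure IsQuantumChannel {a b : Type*} [Fintype a] [Fintype b]
    (N : Matrix a a ℂ →ₗ[ℂ] Matrix b b ℂ) : Prop where
  completely_positive : ∀ (n : ℕ) (X : Matrix (Fin n × a) (Fin n × a) ℂ),
    X.PosSemidef → (ampliation n N X).PosSemidef
  trace_preserving : ∀ X, (N X).trace = X.trace

/-- The partial trace `tr_E` of an operator on `B ⊗ E`. -/
def traceRight {b e : Type*} [Fintype e] (X : Matrix (b × e) (b × e) ℂ) : Matrix b b ℂ :=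
  Matrix.of fun i j => ∑ k, X (i, k) (j, k)

/-- The partial trace `tr_B` of an operator on `B ⊗ E`. -/
def traceLeft {b e : Type*} [Fintype b] (X : Matrix (b × e) (b × e) ℂ) : Matrix e e ℂ :=
  Matrix.of fun k l => ∑ i, X (i, k) (i, l)

/-- `Nc` is a complementary channel of `N`: for some Stinespring dilation of `N`, that is, an
isometry `V` from `A` to `B ⊗ E` with `N X = tr_E (V X Vᴴ)`, one has `Nc X = tr_B (V X Vᴴ)`. -/
def IsComplementaryChannel {a b e : Type*} [Fintype a] [DecidableEq a] [Fintype b] [Fintype e]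
    (N : Matrix a a ℂ →ₗ[ℂ] Matrix b b ℂ) (Nc : Matrix a a ℂ →ₗ[ℂ] Matrix e e ℂ) : Prop :=
  ∃ V : Matrix (b × e) a ℂ, Vᴴ * V = 1 ∧
    (∀ X, N X = traceRight (V * X * Vᴴ)) ∧ (∀ X, Nc X = traceLeft (V * X * Vᴴ))

/-! ### Eigenvalues of a one-parameter family -/

/-- For all `t` near `t₀`, the numbers `p k t` are the eigenvalues of `ρ t`, listed with
multiplicity. -/
def IsEigenvalueFamilyNear {b : Type*} [Fintype b] [DecidableEq b]
    (ρ : ℝ → Matrix b b ℂ) (t₀ : ℝ) (p : b → ℝ → ℝ) : Prop :=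
  ∀ᶠ t in 𝓝 t₀, (ρ t).charpoly = ∏ k, (Polynomial.X - Polynomial.C ((p k t : ℝ) : ℂ))

/-- `f` is twice differentiable at `x`, with second derivative `f₂` there. -/
def HasSecondDerivAt (f : ℝ → ℝ) (f₂ : ℝ) (x : ℝ) : Prop :=
  ∃ f₁ : ℝ → ℝ, (∀ᶠ y in 𝓝 x, HasDerivAt f (f₁ y) y) ∧ HasDerivAt f₁ f₂ x

end BipartiteUncertainty

open BipartiteUncertainty

/-!
With `φ = ψ t₀ η₀`, the velocity of the state vector in `t` is `ξ = -i (H - η₀) φ`, orthogonal to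
`φ`. Optimality of `T` is the equality case of the Cauchy–Schwarz inequality and gives
`(T - t₀) φ = ξ / (2 ‖ξ‖ ^ 2)`, so the velocity in `η` is `i ξ / (2 ‖ξ‖ ^ 2)`: up to scale the two
directions differ by a factor `i`. Alice's Fisher informations are `4 ‖ξ‖ ^ 2` and `1 / ‖ξ‖ ^ 2`.

Write `V φ` and `V ξ` as matrices `M`, `X` with rows in `B` and columns in `E`. The marginals of
`V φ` are `M Mᴴ` and, up to a transposition, `Mᴴ M`; the directions in question are
`X Mᴴ + M Xᴴ` and, up to scale, `i (Mᴴ X - Xᴴ M)`. Let `R` and `S` be their symmetric logarithmic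
derivatives. If `X` has no component from `ker M` to `ker Mᴴ`, then `2 X = R M - i M S`
(`exists_isSLD_isSLD_split`). Taking norms, the cross terms cancel because `tr (Mᴴ R M S)` is real,
and the Fisher informations `‖R M‖ ^ 2` and `‖M S‖ ^ 2` add up to `4 ‖X‖ ^ 2 = 4 ‖ξ‖ ^ 2`
(`exists_hasFisherInfo_add_eq`). After normalisation this is the claim.

The rank hypothesis provides the missing component. The eigenvalues of Bob's state that vanish
at `t₀` are non-negative, so they are `o((t - t₀) ^ 2)`. Their eigenvectors accumulate, by
compactness of the unitary group, at a basis of `ker Mᴴ`, and on `ker M` the dilated vector is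
`(t - t₀) X` to first order; hence `uᴴ X w = 0` for `u ∈ ker Mᴴ` and `w ∈ ker M`
(`dotProduct_eq_zero_of_isLittleO`).
-/

namespace BipartiteUncertainty

/-! ### Symmetric logarithmic derivatives -/

theorem IsSLD.mul_add_mul {a : Type*} [Fintype a] {ρ D R : Matrix a a ℂ} (h : IsSLD ρ D R) :
    ρ * R + R * ρ = (2 : ℂ) • D := by
  rw [← h.2, smul_smul]
  norm_num

/-- The Fisher information is the pairing of the direction with the logarithmic derivative. -/
theorem IsSLD.trace_mul_sq {a : Type*} [Fintype a] [DecidableEq a] {ρ D R : Matrix a a ℂ}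
    (h : IsSLD ρ D R) : (ρ * R ^ 2).trace = (D * R).trace := by
  have h1 : (R * ρ * R).trace = (ρ * R ^ 2).trace := by
    rw [mul_assoc, Matrix.trace_mul_comm, mul_assoc, pow_two]
  rw [← h.2, smul_mul_assoc, Matrix.trace_smul, add_mul, Matrix.trace_add, h1, mul_assoc,
    ← pow_two, smul_eq_mul]
  ring

theorem IsSLD.trace_mul_comm {a : Type*} [Fintype a] {ρ D R R' : Matrix a a ℂ}
    (h : IsSLD ρ D R) (h' : IsSLD ρ D R') : (D * R).trace = (D * R').trace := by
  have h1 : (D * R).trace = (1 / 2 : ℂ) * ((ρ * R' * R).trace + (R' * ρ * R).trace) := by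
    rw [← h'.2, smul_mul_assoc, Matrix.trace_smul, add_mul, Matrix.trace_add, smul_eq_mul]
  have h2 : (D * R').trace = (1 / 2 : ℂ) * ((ρ * R * R').trace + (R * ρ * R').trace) := by
    rw [← h.2, smul_mul_assoc, Matrix.trace_smul, add_mul, Matrix.trace_add, smul_eq_mul]
  rw [h1, h2, Matrix.trace_mul_cycle R' ρ R, Matrix.trace_mul_cycle R ρ R',
    Matrix.trace_mul_cycle R R' ρ, Matrix.trace_mul_cycle R' R ρ]
  ring

/-- The Fisher information may be computed from any one logarithmic derivative. -/
theorem IsSLD.hasFisherInfo {a : Type*} [Fintype a] [DecidableEq a] {ρ D R : Matrix a a ℂ}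
    (h : IsSLD ρ D R) {F : ℝ} (hF : (ρ * R ^ 2).trace = (F : ℂ)) : HasFisherInfo ρ D F := by
  refine ⟨⟨R, h⟩, fun R' h' => ?_⟩
  rw [h'.trace_mul_sq, h'.trace_mul_comm h, ← h.trace_mul_sq, hF]

theorem HasFisherInfo.smul {a : Type*} [Fintype a] [DecidableEq a] {ρ D : Matrix a a ℂ} {F : ℝ}
    (h : HasFisherInfo ρ D F) (c : ℝ) : HasFisherInfo ρ ((c : ℂ) • D) (c ^ 2 * F) := by
  obtain ⟨R, hR⟩ := h.1
  have h' : IsSLD ρ ((c : ℂ) • D) ((c : ℂ) • R) := by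
    refine ⟨?_, ?_⟩
    · simp [Matrix.IsHermitian, hR.1.eq]
    · rw [← hR.2, mul_smul_comm, smul_mul_assoc, ← smul_add, smul_comm]
  refine h'.hasFisherInfo ?_
  rw [smul_pow, mul_smul_comm, Matrix.trace_smul, h.2 R hR]
  simp

theorem HasFisherInfo.transpose {a : Type*} [Fintype a] [DecidableEq a] {ρ D : Matrix a a ℂ}
    {F : ℝ} (h : HasFisherInfo ρ D F) : HasFisherInfo ρᵀ Dᵀ F := by
  obtain ⟨R, hR⟩ := h.1
  have h' : IsSLD ρᵀ Dᵀ Rᵀ := by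
    refine ⟨hR.1.transpose, ?_⟩
    rw [← hR.2, Matrix.transpose_smul, Matrix.transpose_add, Matrix.transpose_mul,
      Matrix.transpose_mul, add_comm]
  refine h'.hasFisherInfo ?_
  rw [← h.2 R hR, ← Matrix.transpose_pow, ← Matrix.transpose_mul, Matrix.trace_transpose,
    Matrix.trace_mul_comm]

/-- In an eigenbasis of `ρ` the entries of a logarithmic derivative are
`2 D k l / (λ k + λ l)`; the hypothesis says that `D k l = 0` wherever the denominator is. -/
theorem exists_isSLD {a : Type*} [Fintype a] [DecidableEq a] {ρ D : Matrix a a ℂ}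
    (hρ : ρ.PosSemidef) (hD : D.IsHermitian)
    (hker : ∀ u v, ρ *ᵥ u = 0 → ρ *ᵥ v = 0 → star u ⬝ᵥ (D *ᵥ v) = 0) : ∃ R, IsSLD ρ D R := by
  set U : Matrix a a ℂ := (hρ.1.eigenvectorUnitary : Matrix a a ℂ) with hU
  have hU1 : Uᴴ * U = 1 := Unitary.coe_star_mul_self hρ.1.eigenvectorUnitary
  have hU2 : U * Uᴴ = 1 := Unitary.coe_mul_star_self hρ.1.eigenvectorUnitary
  set l : a → ℝ := hρ.1.eigenvalues with hl
  have hspec : ρ = U * Matrix.diagonal (fun i => (l i : ℂ)) * Uᴴ := by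
    conv_lhs => rw [hρ.1.spectral_theorem]
    rfl
  have hl0 : ∀ i, 0 ≤ l i := hρ.eigenvalues_nonneg
  set D' : Matrix a a ℂ := Uᴴ * D * U with hD'
  have hD'h : D'.IsHermitian := Matrix.isHermitian_conjTranspose_mul_mul U hD
  have hcol : ∀ i, l i = 0 → ρ *ᵥ (fun k => U k i) = 0 := by
    intro i hi
    have h1 : ρ * U = U * Matrix.diagonal (fun i => (l i : ℂ)) := by
      rw [hspec, mul_assoc, hU1, mul_one]
    funext k
    have := congrFun (congrFun h1 k) i
    rw [Matrix.mul_diagonal, hi] at this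
    simpa [Matrix.mul_apply, Matrix.mulVec, dotProduct] using this
  have hD0 : ∀ i j, l i + l j = 0 → D' i j = 0 := by
    intro i j hij
    have h1 : l i = 0 := by linarith [hl0 i, hl0 j]
    have h2 : l j = 0 := by linarith [hl0 i, hl0 j]
    have := hker _ _ (hcol i h1) (hcol j h2)
    rw [← this, hD', mul_assoc]
    simp [Matrix.mul_apply, Matrix.mulVec, dotProduct]
  set R' : Matrix a a ℂ := Matrix.of fun i j => 2 * D' i j / ((l i + l j : ℝ) : ℂ) with hR'
  have hR'h : R'.IsHermitian := by
    ext i j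
    have h := hD'h.apply i j
    simp only [Matrix.conjTranspose_apply, hR', Matrix.of_apply, star_div₀, star_mul', h]
    simp [add_comm]
  refine ⟨U * R' * Uᴴ, Matrix.isHermitian_mul_mul_conjTranspose U hR'h, ?_⟩
  have hdiag : (1 / 2 : ℂ) • (Matrix.diagonal (fun i => (l i : ℂ)) * R' +
      R' * Matrix.diagonal (fun i => (l i : ℂ))) = D' := by
    ext i j
    simp only [Matrix.smul_apply, Matrix.add_apply, Matrix.diagonal_mul, Matrix.mul_diagonal, hR',
      Matrix.of_apply, smul_eq_mul]
    by_cases hij : l i + l j = 0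
    · simp [hij, hD0 i j hij]
    · have : (l i : ℂ) + (l j : ℂ) ≠ 0 := by exact_mod_cast hij
      push_cast
      field_simp
  have h1 : ρ * (U * R' * Uᴴ) = U * (Matrix.diagonal (fun i => (l i : ℂ)) * R') * Uᴴ := by
    rw [hspec]
    calc _ = U * Matrix.diagonal (fun i => (l i : ℂ)) * (Uᴴ * U) * R' * Uᴴ := by
          simp only [mul_assoc]
      _ = _ := by rw [hU1]; simp only [mul_assoc, mul_one]
  have h2 : (U * R' * Uᴴ) * ρ = U * (R' * Matrix.diagonal (fun i => (l i : ℂ))) * Uᴴ := by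
    rw [hspec]
    calc _ = U * R' * (Uᴴ * U) * Matrix.diagonal (fun i => (l i : ℂ)) * Uᴴ := by
          simp only [mul_assoc]
      _ = _ := by rw [hU1]; simp only [mul_assoc, mul_one]
  rw [h1, h2, ← add_mul, ← mul_add, ← smul_mul_assoc, ← mul_smul_comm, hdiag, hD']
  calc _ = (U * Uᴴ) * D * (U * Uᴴ) := by simp only [mul_assoc]
    _ = D := by rw [hU2, one_mul, mul_one]

/-! ### Fisher informations of the two marginals of a bipartite vector -/

/-- The two Sylvester-type conditions force `Y` to map the kernel of `M` into that of `Mᴴ` and to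
vanish on its orthogonal complement; the last hypothesis excludes the remaining block. -/
theorem eq_zero_of_sylvester {b e : Type*} [Fintype b] [Fintype e] {M Y : Matrix b e ℂ}
    (h1 : Y * Mᴴ + M * Yᴴ = 0) (h2 : Mᴴ * Y = Yᴴ * M)
    (h3 : ∀ u w, Mᴴ *ᵥ u = 0 → M *ᵥ w = 0 → star u ⬝ᵥ (Y *ᵥ w) = 0) : Y = 0 := by
  -- `‖Y Mᴴ‖ ^ 2 + ‖Mᴴ Y‖ ^ 2 = 0`
  have hsum : ((Y * Mᴴ)ᴴ * (Y * Mᴴ)).trace + ((Mᴴ * Y)ᴴ * (Mᴴ * Y)).trace = 0 := by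
    have e1 : Y * Mᴴ = -(M * Yᴴ) := eq_neg_of_add_eq_zero_left h1
    have a1 : ((Y * Mᴴ)ᴴ * (Y * Mᴴ)).trace = -((M * Yᴴ) * (M * Yᴴ)).trace := by
      rw [e1]
      simp only [Matrix.conjTranspose_neg, Matrix.conjTranspose_mul,
        Matrix.conjTranspose_conjTranspose, neg_mul, mul_neg, neg_neg]
      rw [e1]
      simp
    have a2 : ((Mᴴ * Y)ᴴ * (Mᴴ * Y)).trace = ((M * Yᴴ) * (M * Yᴴ)).trace := by
      rw [Matrix.conjTranspose_mul, Matrix.conjTranspose_conjTranspose, h2,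
        Matrix.trace_mul_comm, Matrix.mul_assoc, Matrix.mul_assoc, Matrix.trace_mul_comm]
      simp only [Matrix.mul_assoc]
    rw [a1, a2, neg_add_cancel]
  have p1 := (Matrix.posSemidef_conjTranspose_mul_self (Y * Mᴴ)).trace_nonneg
  have p2 := (Matrix.posSemidef_conjTranspose_mul_self (Mᴴ * Y)).trace_nonneg
  obtain ⟨q1, q2⟩ := (add_eq_zero_iff_of_nonneg p1 p2).1 hsum
  have z1 : Y * Mᴴ = 0 := Matrix.trace_conjTranspose_mul_self_eq_zero_iff.1 q1
  have z2 : Mᴴ * Y = 0 := Matrix.trace_conjTranspose_mul_self_eq_zero_iff.1 q2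
  have z3 : M * Yᴴ = 0 := by
    simpa using congrArg Matrix.conjTranspose z1
  -- the columns of `Yᴴ` lie in the kernel of `M`, their images under `Y` in that of `Mᴴ`
  have z4 : Y * Yᴴ = 0 := by
    ext i j
    have hw : M *ᵥ (fun k => Yᴴ k j) = 0 := by
      funext r
      simpa [Matrix.mul_apply, Matrix.mulVec, dotProduct] using congrFun (congrFun z3 r) j
    have hu : Mᴴ *ᵥ (Y *ᵥ (fun k => Yᴴ k j)) = 0 := by
      rw [Matrix.mulVec_mulVec, z2, Matrix.zero_mulVec]
    have h0 := dotProduct_star_self_eq_zero.1 (h3 _ _ hu hw)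
    simpa [Matrix.mul_apply, Matrix.mulVec, dotProduct] using congrFun h0 i
  exact Matrix.self_mul_conjTranspose_eq_zero.1 z4

/-- A tangent vector `X` at the bipartite vector `M` without component between the two kernels
splits as `2 X = R M - i M S`, where `R` is the logarithmic derivative of the left marginal along
`X` and `S` that of the right marginal along `i X`. -/
theorem exists_isSLD_isSLD_split {b e : Type*} [Fintype b] [DecidableEq b] [Fintype e]
    [DecidableEq e] (M X : Matrix b e ℂ)
    (hX : ∀ u w, Mᴴ *ᵥ u = 0 → M *ᵥ w = 0 → star u ⬝ᵥ (X *ᵥ w) = 0) :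
    ∃ R S, IsSLD (M * Mᴴ) (X * Mᴴ + M * Xᴴ) R ∧
      IsSLD (Mᴴ * M) (Complex.I • (Mᴴ * X - Xᴴ * M)) S ∧
      (2 : ℂ) • X = R * M - Complex.I • (M * S) := by
  obtain ⟨R, hR⟩ := exists_isSLD (Matrix.posSemidef_self_mul_conjTranspose M)
    (D := X * Mᴴ + M * Xᴴ)
    (by simp [Matrix.IsHermitian, add_comm]) (by
      intro u v hu hv
      have hu' := (Matrix.self_mul_conjTranspose_mulVec_eq_zero M u).1 hu
      have hv' := (Matrix.self_mul_conjTranspose_mulVec_eq_zero M v).1 hv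
      have hu'' : star u ᵥ* M = 0 := by
        rw [← Matrix.conjTranspose_conjTranspose M, ← Matrix.star_mulVec, hu', star_zero]
      rw [Matrix.add_mulVec, ← Matrix.mulVec_mulVec, hv', Matrix.mulVec_zero, zero_add,
        ← Matrix.mulVec_mulVec, Matrix.dotProduct_mulVec, hu'', zero_dotProduct])
  obtain ⟨S, hS⟩ := exists_isSLD (Matrix.posSemidef_conjTranspose_mul_self M)
    (D := Complex.I • (Mᴴ * X - Xᴴ * M))
    (by
      simp only [Matrix.IsHermitian, Matrix.conjTranspose_smul, Matrix.conjTranspose_sub,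
        Matrix.conjTranspose_mul, Matrix.conjTranspose_conjTranspose, Complex.star_def,
        Complex.conj_I]
      rw [neg_smul, ← smul_neg, neg_sub]) (by
      intro u v hu hv
      have hu' := (Matrix.conjTranspose_mul_self_mulVec_eq_zero M u).1 hu
      have hv' := (Matrix.conjTranspose_mul_self_mulVec_eq_zero M v).1 hv
      have hu'' : star u ᵥ* Mᴴ = 0 := by
        rw [← Matrix.star_mulVec, hu', star_zero]
      rw [Matrix.smul_mulVec, Matrix.sub_mulVec, ← Matrix.mulVec_mulVec, ← Matrix.mulVec_mulVec,
        hv', Matrix.mulVec_zero, sub_zero, dotProduct_smul, Matrix.dotProduct_mulVec, hu'',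
        zero_dotProduct, smul_zero])
  refine ⟨R, S, hR, hS, ?_⟩
  have eR := hR.mul_add_mul
  have eS := hS.mul_add_mul
  have hRh := hR.1.eq
  have hSh := hS.1.eq
  rw [← sub_eq_zero]
  refine eq_zero_of_sylvester (M := M) ?_ ?_ ?_
  · simp only [Matrix.conjTranspose_smul, Matrix.conjTranspose_sub, Matrix.conjTranspose_mul,
      hRh, hSh, Complex.star_def, Complex.conj_I, Matrix.sub_mul, Matrix.mul_sub,
      Matrix.smul_mul, Matrix.mul_smul, map_ofNat]
    have : (2 : ℂ) • (X * Mᴴ) + (2 : ℂ) • (M * Xᴴ) = M * Mᴴ * R + R * (M * Mᴴ) := by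
      rw [eR, smul_add]
    rw [Matrix.mul_assoc] at this
    simp only [Matrix.mul_assoc, neg_smul]
    linear_combination (norm := module) this
  · simp only [Matrix.conjTranspose_smul, Matrix.conjTranspose_sub, Matrix.conjTranspose_mul,
      hRh, hSh, Complex.star_def, Complex.conj_I, Matrix.sub_mul, Matrix.mul_sub,
      Matrix.smul_mul, Matrix.mul_smul, map_ofNat]
    have : (2 : ℂ) • (Mᴴ * X) - (2 : ℂ) • (Xᴴ * M) =
        (-Complex.I) • (Mᴴ * M * S + S * (Mᴴ * M)) := by
      rw [eS, smul_smul, smul_smul, ← smul_sub]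
      congr 1
      linear_combination (2 : ℂ) * Complex.I_mul_I
    rw [Matrix.mul_assoc, smul_add] at this
    simp only [Matrix.mul_assoc, neg_smul] at this ⊢
    linear_combination (norm := module) this
  · intro u w hu hw
    have hu'' : star u ᵥ* M = 0 := by
      rw [← Matrix.conjTranspose_conjTranspose M, ← Matrix.star_mulVec, hu, star_zero]
    rw [Matrix.sub_mulVec, Matrix.sub_mulVec, Matrix.smul_mulVec, Matrix.smul_mulVec,
      ← Matrix.mulVec_mulVec, hw, Matrix.mulVec_zero, ← Matrix.mulVec_mulVec, dotProduct_sub,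
      dotProduct_sub, dotProduct_smul, hX u w hu hw, dotProduct_smul, Matrix.dotProduct_mulVec _ M,
      hu'']
    simp

/-- The Fisher informations of the two marginals, along `X` and along `i X`, add up to
`4 ‖X‖ ^ 2`. -/
theorem exists_hasFisherInfo_add_eq {b e : Type*} [Fintype b] [DecidableEq b] [Fintype e]
    [DecidableEq e] (M X : Matrix b e ℂ)
    (hX : ∀ u w, Mᴴ *ᵥ u = 0 → M *ᵥ w = 0 → star u ⬝ᵥ (X *ᵥ w) = 0) :
    ∃ F G : ℝ, HasFisherInfo (M * Mᴴ) (X * Mᴴ + M * Xᴴ) F ∧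
      HasFisherInfo (Mᴴ * M) (Complex.I • (Mᴴ * X - Xᴴ * M)) G ∧
      ((F + G : ℝ) : ℂ) = 4 * (Xᴴ * X).trace := by
  obtain ⟨R, S, hR, hS, h⟩ := exists_isSLD_isSLD_split M X hX
  have hRh := hR.1.eq
  have hSh := hS.1.eq
  have tR : (M * Mᴴ * R ^ 2).trace = ((R * M)ᴴ * (R * M)).trace := by
    rw [Matrix.conjTranspose_mul, hRh, pow_two, Matrix.mul_assoc, Matrix.trace_mul_comm]
    simp only [Matrix.mul_assoc]
  have tS : (Mᴴ * M * S ^ 2).trace = ((M * S)ᴴ * (M * S)).trace := by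
    rw [Matrix.conjTranspose_mul, hSh, pow_two, ← Matrix.mul_assoc, Matrix.trace_mul_comm]
    simp only [Matrix.mul_assoc]
  have real : ∀ Z : Matrix b e ℂ, ((Zᴴ * Z).trace.re : ℂ) = (Zᴴ * Z).trace := by
    intro Z
    have := (Matrix.posSemidef_conjTranspose_mul_self Z).trace_nonneg
    exact (Complex.eq_re_of_ofReal_le (r := 0) (by simpa using this)).symm
  refine ⟨((R * M)ᴴ * (R * M)).trace.re, ((M * S)ᴴ * (M * S)).trace.re,
    hR.hasFisherInfo (by rw [tR, real]), hS.hasFisherInfo (by rw [tS, real]), ?_⟩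
  have hsq : (4 : ℂ) * (Xᴴ * X).trace = (((2 : ℂ) • X)ᴴ * ((2 : ℂ) • X)).trace := by
    simp only [Matrix.conjTranspose_smul, Matrix.smul_mul, Matrix.mul_smul, Matrix.trace_smul,
      Complex.star_def, map_ofNat, smul_eq_mul]
    ring
  -- the cross terms cancel because `tr ((Mᴴ R M) S)` is real
  have hcross : ((R * M)ᴴ * (M * S)).trace = ((M * S)ᴴ * (R * M)).trace := by
    rw [Matrix.conjTranspose_mul, Matrix.conjTranspose_mul, hRh, hSh, Matrix.mul_assoc S,
      Matrix.trace_mul_comm S]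
    simp only [Matrix.mul_assoc]
  rw [hsq, h]
  simp only [Matrix.conjTranspose_sub, Matrix.conjTranspose_smul, Matrix.sub_mul, Matrix.mul_sub,
    Matrix.smul_mul, Matrix.mul_smul, Matrix.trace_sub, Matrix.trace_smul, Complex.star_def,
    Complex.conj_I, smul_eq_mul, Complex.ofReal_add, real, hcross]
  linear_combination (((M * S)ᴴ * (M * S)).trace) * Complex.I_mul_I

/-! ### Eigenvalues that vanish to second order -/

/-- A non-negative function with a zero at `x` has a minimum there, so its derivative vanishes as
well. -/
theorem HasSecondDerivAt.isLittleO_sq {f : ℝ → ℝ} {x : ℝ} (h : HasSecondDerivAt f 0 x)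
    (hx : f x = 0) (hf : ∀ᶠ y in 𝓝 x, 0 ≤ f y) : f =o[𝓝 x] fun y => (y - x) ^ 2 := by
  obtain ⟨f₁, h₁, h₂⟩ := h
  have hmin : IsLocalMin f x := by
    filter_upwards [hf] with y hy
    rwa [hx]
  have hf₁ : f₁ x = 0 := hmin.hasDerivAt_eq_zero h₁.self_of_nhds
  rw [hasDerivAt_iff_isLittleO] at h₂
  rw [Asymptotics.isLittleO_iff]
  intro c hc
  have h₃ := h₂.def hc
  obtain ⟨δ, hδ, hball⟩ := Metric.eventually_nhds_iff_ball.1 (h₁.and h₃)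
  filter_upwards [Metric.ball_mem_nhds x hδ] with y hy
  have hsub : ∀ z ∈ Metric.closedBall x |y - x|, z ∈ Metric.ball x δ := by
    intro z hz
    rw [Metric.mem_closedBall] at hz
    rw [Metric.mem_ball, Real.dist_eq] at hy
    exact lt_of_le_of_lt hz hy
  have key := (convex_closedBall x |y - x|).norm_image_sub_le_of_norm_hasDerivWithin_le
    (f := f) (f' := f₁) (C := c * |y - x|) (x := x) (y := y)
    (fun z hz => (hball z (hsub z hz)).1.hasDerivWithinAt) (fun z hz => by
      have := (hball z (hsub z hz)).2
      simp only [hf₁, sub_zero, smul_zero, Real.norm_eq_abs] at this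
      refine this.trans ?_
      rw [Metric.mem_closedBall, Real.dist_eq] at hz
      gcongr) (by simp) (by simp [Real.dist_eq])
  rw [hx, sub_zero, Real.norm_eq_abs (y - x)] at key
  rw [norm_pow, Real.norm_eq_abs (y - x)]
  linarith

theorem exists_perm_of_prod_X_sub_C_eq {ι K : Type*} [Fintype ι] [Field K] {f g : ι → K}
    (h : ∏ i, (Polynomial.X - Polynomial.C (f i)) = ∏ i, (Polynomial.X - Polynomial.C (g i))) :
    ∃ σ : Equiv.Perm ι, ∀ i, g (σ i) = f i := by
  classical
  have hroots := congrArg Polynomial.roots h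
  have hr : ∀ f : ι → K, (∏ i, (Polynomial.X - Polynomial.C (f i))).roots =
      Finset.univ.val.map f := by
    intro f
    rw [← Polynomial.roots_multiset_prod_X_sub_C (Finset.univ.val.map f), Multiset.map_map]
    rfl
  rw [hr, hr] at hroots
  have hcard : ∀ c, Fintype.card {i // f i = c} = Fintype.card {i // g i = c} := by
    intro c
    have := congrArg (Multiset.count c) hroots
    rw [Multiset.count_map, Multiset.count_map] at this
    rw [Fintype.card_subtype, Fintype.card_subtype]
    simpa [Finset.card, Finset.filter, eq_comm] using this
  exact ⟨Equiv.ofFiberEquiv fun c => Fintype.equivOfCardEq (hcard c),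
    fun i => Equiv.ofFiberEquiv_map _ i⟩

/-- A Hermitian matrix has a unitary diagonalisation with its eigenvalues in any given order. -/
theorem exists_unitary_conj_eq_diagonal {b : Type*} [Fintype b] [DecidableEq b]
    {ρ : Matrix b b ℂ} (hρ : ρ.IsHermitian) {p : b → ℝ}
    (hp : ρ.charpoly = ∏ k, (Polynomial.X - Polynomial.C ((p k : ℝ) : ℂ))) :
    ∃ U ∈ Matrix.unitaryGroup b ℂ, Uᴴ * ρ * U = Matrix.diagonal fun k => (p k : ℂ) := by
  obtain ⟨σ, hσ⟩ := exists_perm_of_prod_X_sub_C_eq (hp.symm.trans hρ.charpoly_eq)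
  set U : Matrix b b ℂ := (hρ.eigenvectorUnitary : Matrix b b ℂ) with hU
  have hU1 : Uᴴ * U = 1 := Unitary.coe_star_mul_self hρ.eigenvectorUnitary
  have hspec : Uᴴ * ρ * U = Matrix.diagonal (fun i => (hρ.eigenvalues i : ℂ)) := by
    have := hρ.conjStarAlgAut_star_eigenvectorUnitary
    rw [Unitary.conjStarAlgAut_star_apply] at this
    exact this
  have hsub : ∀ A : Matrix b b ℂ,
      (U.submatrix id σ)ᴴ * A * U.submatrix id σ = (Uᴴ * A * U).submatrix σ σ := by
    intro A
    ext i j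
    simp [Matrix.mul_apply]
  refine ⟨U.submatrix id σ, ?_, ?_⟩
  · rw [Matrix.mem_unitaryGroup_iff', Matrix.star_eq_conjTranspose]
    have := hsub 1
    rw [mul_one, mul_one, hU1] at this
    rw [this, Matrix.submatrix_one_equiv]
  · rw [hsub, hspec]
    ext i j
    by_cases hij : i = j
    · subst hij
      simpa using hσ i
    · have : σ i ≠ σ j := fun h => hij (σ.injective h)
      simp [hij, this]

theorem isCompact_unitaryGroup (b : Type*) [Fintype b] [DecidableEq b] :
    IsCompact (Matrix.unitaryGroup b ℂ : Set (Matrix b b ℂ)) := by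
  have hK : IsCompact (Set.univ.pi fun _ : b => Set.univ.pi fun _ : b =>
      Metric.closedBall (0 : ℂ) 1) :=
    isCompact_univ_pi fun _ => isCompact_univ_pi fun _ => isCompact_closedBall _ _
  refine IsCompact.of_isClosed_subset (X := Matrix b b ℂ) hK ?_ ?_
  · have : (Matrix.unitaryGroup b ℂ : Set (Matrix b b ℂ)) = {U | Uᴴ * U = 1} := by
      ext U
      exact Matrix.mem_unitaryGroup_iff'
    rw [this]
    exact isClosed_eq (by fun_prop) continuous_const
  · intro U hU i _ j _
    simpa using entry_norm_bound_of_unitary hU i j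

theorem norm_mulVec_sq_le {b e : Type*} [Fintype b] [Fintype e]
    (A : Matrix b e ℂ) (w : e → ℂ) (k : b) :
    ‖(A *ᵥ w) k‖ ^ 2 ≤ ((A * Aᴴ) k k).re * ∑ j, ‖w j‖ ^ 2 := by
  have h1 : ((A * Aᴴ) k k).re = ∑ j, ‖A k j‖ ^ 2 := by
    rw [Matrix.mul_apply, Complex.re_sum]
    refine Finset.sum_congr rfl fun j _ => ?_
    rw [Matrix.conjTranspose_apply, Complex.star_def, Complex.mul_conj, Complex.ofReal_re,
      Complex.normSq_eq_norm_sq]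
  have h2 : ‖(A *ᵥ w) k‖ ≤ ∑ j, ‖A k j‖ * ‖w j‖ := by
    refine (norm_sum_le _ _).trans_eq ?_
    simp
  rw [h1]
  exact (pow_le_pow_left₀ (norm_nonneg _) h2 2).trans (Finset.sum_mul_sq_le_sq_mul_sq _ _ _)

theorem tendsto_mulVec {α b e : Type*} [Fintype e] {l : Filter α} {A : α → Matrix b e ℂ}
    {A₀ : Matrix b e ℂ} {v : α → e → ℂ} {v₀ : e → ℂ} (hA : Filter.Tendsto A l (𝓝 A₀))
    (hv : Filter.Tendsto v l (𝓝 v₀)) : Filter.Tendsto (fun i => A i *ᵥ v i) l (𝓝 (A₀ *ᵥ v₀)) := by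
  refine tendsto_pi_nhds.2 fun k => tendsto_finsetSum _ fun j _ => ?_
  exact (tendsto_pi_nhds.1 (tendsto_pi_nhds.1 hA k) j).mul (tendsto_pi_nhds.1 hv j)

theorem norm_conjTranspose_mulVec_sq_le {b e : Type*} [Fintype b] [DecidableEq b] [Fintype e]
    {ρ U : Matrix b b ℂ} {G : Matrix b e ℂ} {p : b → ℝ} (hG : (ρ - G * Gᴴ).PosSemidef)
    (hU : Uᴴ * ρ * U = Matrix.diagonal fun k => (p k : ℂ)) (w : e → ℂ) (k : b) :
    ‖(Uᴴ *ᵥ (G *ᵥ w)) k‖ ^ 2 ≤ p k * ∑ j, ‖w j‖ ^ 2 := by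
  have h2 : (((Uᴴ * G) * (Uᴴ * G)ᴴ) k k).re ≤ p k := by
    have h3 := (hG.conjTranspose_mul_mul_same U).diag_nonneg (i := k)
    rw [Matrix.mul_sub, Matrix.sub_mul, hU, Matrix.sub_apply, Matrix.diagonal_apply_eq] at h3
    have h4 := (Complex.le_def.1 h3).1
    simp only [Complex.zero_re, Complex.sub_re, Complex.ofReal_re] at h4
    rw [Matrix.conjTranspose_mul, Matrix.conjTranspose_conjTranspose]
    have h5 : Uᴴ * G * (Gᴴ * U) = Uᴴ * (G * Gᴴ) * U := by
      simp only [Matrix.mul_assoc]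
    rw [h5]
    linarith
  rw [Matrix.mulVec_mulVec]
  refine (norm_mulVec_sq_le _ w k).trans ?_
  gcongr

/-- If the eigenvalues of `ρ t` that vanish at `t₀` vanish to more than second order, then for
every curve `G` with `G t * (G t)ᴴ ≤ ρ t` and every `w` such that `G t w` vanishes at `t₀`, the
velocity `x` of `G t w` is orthogonal to the kernel of `ρ t₀`. Eigenvectors `v` of the small
eigenvalues satisfy `‖(G t)ᴴ v‖ = o(t - t₀)`, and their limits span that kernel. -/
theorem dotProduct_eq_zero_of_isLittleO {b e : Type*} [Fintype b] [DecidableEq b]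
    [Fintype e] {ρ : ℝ → Matrix b b ℂ} {G : ℝ → Matrix b e ℂ} {t₀ : ℝ}
    {p : b → ℝ → ℝ} (hρ : ∀ t, (ρ t).IsHermitian) (hcont : Filter.Tendsto ρ (𝓝[≠] t₀) (𝓝 (ρ t₀)))
    (hG : ∀ t, (ρ t - G t * (G t)ᴴ).PosSemidef)
    (hp : IsEigenvalueFamilyNear ρ t₀ p)
    (hrank : ∀ k, p k t₀ = 0 → p k =o[𝓝 t₀] fun t => (t - t₀) ^ 2)
    {u x : b → ℂ} {w : e → ℂ} (hu : ρ t₀ *ᵥ u = 0)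
    (hx : Filter.Tendsto (fun t => ((t - t₀ : ℝ) : ℂ)⁻¹ • (G t *ᵥ w)) (𝓝[≠] t₀) (𝓝 x)) :
    star u ⬝ᵥ x = 0 := by
  -- unitary diagonalisations converge along an ultrafilter
  have hex : ∀ t, ∃ U ∈ Matrix.unitaryGroup b ℂ,
      (ρ t).charpoly = ∏ k, (Polynomial.X - Polynomial.C ((p k t : ℝ) : ℂ)) →
      Uᴴ * ρ t * U = Matrix.diagonal fun k => (p k t : ℂ) := by
    intro t
    by_cases h : (ρ t).charpoly = ∏ k, (Polynomial.X - Polynomial.C ((p k t : ℝ) : ℂ))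
    · obtain ⟨U, hU, hU'⟩ := exists_unitary_conj_eq_diagonal (hρ t) h
      exact ⟨U, hU, fun _ => hU'⟩
    · exact ⟨1, one_mem _, fun h' => absurd h' h⟩
  choose U hU hUdiag using hex
  let 𝒰 : Ultrafilter ℝ := Ultrafilter.of (𝓝[≠] t₀)
  have h𝒰 : (𝒰 : Filter ℝ) ≤ 𝓝[≠] t₀ := Ultrafilter.of_le _
  obtain ⟨V, hV, hVlim⟩ := (isCompact_unitaryGroup b).ultrafilter_le_nhds (𝒰.map U)
    (Filter.le_principal_iff.2 (Filter.mem_map.2 (Filter.Eventually.of_forall hU)))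
  replace hVlim : Filter.Tendsto U 𝒰 (𝓝 V) := hVlim
  have hVstar : Filter.Tendsto (fun t => (U t)ᴴ) 𝒰 (𝓝 Vᴴ) :=
    (continuous_id.matrix_conjTranspose.tendsto V).comp hVlim
  have hVV : V * Vᴴ = 1 := Matrix.mem_unitaryGroup_iff.1 hV
  set Λ : Matrix b b ℂ := Vᴴ * ρ t₀ * V with hΛ
  have hdiag : ∀ᶠ t in (𝒰 : Filter ℝ),
      (U t)ᴴ * ρ t * U t = Matrix.diagonal fun k => (p k t : ℂ) := by
    have : ∀ᶠ t in 𝓝[≠] t₀, (U t)ᴴ * ρ t * U t = Matrix.diagonal fun k => (p k t : ℂ) :=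
      (hp.filter_mono nhdsWithin_le_nhds).mono fun t ht => hUdiag t ht
    exact h𝒰 this
  have hΛlim : Filter.Tendsto (fun t => Matrix.diagonal fun k => (p k t : ℂ)) 𝒰 (𝓝 Λ) :=
    Filter.Tendsto.congr' hdiag ((hVstar.mul (hcont.mono_left h𝒰)).mul hVlim)
  have hentry : ∀ i j, Filter.Tendsto
      (fun t => (Matrix.diagonal fun k => (p k t : ℂ)) i j) 𝒰 (𝓝 (Λ i j)) := fun i j =>
    ((continuous_id.matrix_elem i j).tendsto Λ).comp hΛlim
  have hΛdiag : Λ = Matrix.diagonal fun k => Λ k k := by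
    ext i j
    by_cases hij : i = j
    · subst hij; simp
    · have := hentry i j
      simp only [Matrix.diagonal_apply_ne _ hij] at this ⊢
      exact tendsto_nhds_unique this tendsto_const_nhds
  have hΛzero : ∀ k, p k t₀ = 0 → Λ k k = 0 := by
    intro k hk
    have h1 : Filter.Tendsto (p k) (𝓝 t₀) (𝓝 0) := by
      refine (hrank k hk).isBigO.trans_tendsto ?_
      have : Continuous fun t : ℝ => (t - t₀) ^ 2 := by fun_prop
      simpa using this.tendsto t₀
    have h2 : Filter.Tendsto (fun t => (p k t : ℂ)) 𝒰 (𝓝 0) := by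
      have := (Complex.continuous_ofReal.tendsto 0).comp
        (h1.mono_left (h𝒰.trans nhdsWithin_le_nhds))
      rwa [Complex.ofReal_zero] at this
    have h3 := hentry k k
    simp only [Matrix.diagonal_apply_eq] at h3
    exact tendsto_nhds_unique h3 h2
  -- the limit has as many zero eigenvalues as `ρ t₀`, so that no other ones converge to zero
  have hΛne : ∀ k, Λ k k = 0 → p k t₀ = 0 := by
    have hchar : Λ.charpoly = (ρ t₀).charpoly := by
      rw [hΛ, Matrix.charpoly_mul_comm, ← mul_assoc, hVV, one_mul]
    rw [hΛdiag, Matrix.charpoly_diagonal, hp.self_of_nhds] at hchar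
    obtain ⟨σ, hσ⟩ := exists_perm_of_prod_X_sub_C_eq hchar
    have hsub : Finset.univ.filter (fun k => p k t₀ = 0) ⊆
        Finset.univ.filter (fun k => Λ k k = 0) := by
      intro k hk
      simp only [Finset.mem_filter, Finset.mem_univ, true_and] at hk ⊢
      exact hΛzero k hk
    have hcard : (Finset.univ.filter (fun k => Λ k k = 0)).card =
        (Finset.univ.filter (fun k => p k t₀ = 0)).card := by
      refine Finset.card_equiv σ fun k => ?_
      simp only [Finset.mem_filter, Finset.mem_univ, true_and]
      rw [← hσ k, Complex.ofReal_eq_zero]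
    have heq := Finset.eq_of_subset_of_card_le hsub hcard.le
    intro k hk
    have : k ∈ Finset.univ.filter (fun k => p k t₀ = 0) := by
      rw [heq]; simpa using hk
    simpa using this
  have hc : ∀ k, p k t₀ ≠ 0 → (Vᴴ *ᵥ u) k = 0 := by
    intro k hk
    have h1 : Λ *ᵥ (Vᴴ *ᵥ u) = 0 := by
      rw [hΛ, Matrix.mulVec_mulVec, mul_assoc, hVV, mul_one, ← Matrix.mulVec_mulVec, hu,
        Matrix.mulVec_zero]
    rw [hΛdiag] at h1
    have h2 := congrFun h1 k
    rw [Matrix.mulVec_diagonal, Pi.zero_apply] at h2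
    exact (mul_eq_zero.1 h2).resolve_left fun h => hk (hΛne k h)
  have hxk : ∀ k, p k t₀ = 0 → (Vᴴ *ᵥ x) k = 0 := by
    intro k hk
    have hlim : Filter.Tendsto (fun t => (U t)ᴴ *ᵥ (((t - t₀ : ℝ) : ℂ)⁻¹ • (G t *ᵥ w))) 𝒰
        (𝓝 (Vᴴ *ᵥ x)) :=
      tendsto_mulVec hVstar (hx.mono_left h𝒰)
    have hlim' := ((((continuous_apply k).tendsto _).comp hlim).norm).pow 2
    have hbound : ∀ᶠ t in (𝒰 : Filter ℝ),
        ‖((U t)ᴴ *ᵥ (((t - t₀ : ℝ) : ℂ)⁻¹ • (G t *ᵥ w))) k‖ ^ 2 ≤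
          p k t / (t - t₀) ^ 2 * ∑ j, ‖w j‖ ^ 2 := by
      filter_upwards [hdiag] with t ht
      have hnorm : ‖((t - t₀ : ℝ) : ℂ)⁻¹‖ ^ 2 = ((t - t₀) ^ 2)⁻¹ := by
        rw [norm_inv, inv_pow, Complex.norm_real, Real.norm_eq_abs, sq_abs]
      rw [Matrix.mulVec_smul, Pi.smul_apply, norm_smul, mul_pow, hnorm, div_eq_inv_mul, mul_assoc]
      exact mul_le_mul_of_nonneg_left (norm_conjTranspose_mulVec_sq_le (hG t) ht w k)
        (by positivity)
    have hzero : Filter.Tendsto (fun t => p k t / (t - t₀) ^ 2 * ∑ j, ‖w j‖ ^ 2) 𝒰 (𝓝 0) := by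
      have := ((hrank k hk).tendsto_div_nhds_zero.mul_const (∑ j, ‖w j‖ ^ 2)).mono_left
        (h𝒰.trans nhdsWithin_le_nhds)
      rwa [zero_mul] at this
    have h0 := le_of_tendsto_of_tendsto hlim' hzero hbound
    have h1 : ‖(Vᴴ *ᵥ x) k‖ ^ 2 = 0 := le_antisymm h0 (by positivity)
    simpa using h1
  have hfin : star u ⬝ᵥ x = star (Vᴴ *ᵥ u) ⬝ᵥ (Vᴴ *ᵥ x) := by
    rw [Matrix.star_mulVec, Matrix.conjTranspose_conjTranspose, ← Matrix.dotProduct_mulVec,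
      Matrix.mulVec_mulVec, hVV, Matrix.one_mulVec]
  rw [hfin]
  refine Finset.sum_eq_zero fun k _ => ?_
  by_cases hk : p k t₀ = 0
  · rw [hxk k hk, mul_zero]
  · rw [Pi.star_apply, hc k hk, star_zero, zero_mul]

/-! ### Tangent vectors of pure states -/

/-- The derivative of the pure state `|v⟩⟨v|` when the vector `v` moves with velocity `x`. -/
def pureTangent {a : Type*} (v x : a → ℂ) : Matrix a a ℂ :=
  Matrix.vecMulVec x (star v) + Matrix.vecMulVec v (star x)

theorem pureState_mulVec {a : Type*} [Fintype a] (v w : a → ℂ) :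
    pureState v *ᵥ w = (star v ⬝ᵥ w) • v := by
  rw [pureState, Matrix.vecMulVec_mulVec]
  ext i
  simp [mul_comm]

theorem pureTangent_mulVec {a : Type*} [Fintype a] {v x : a → ℂ} (hv : star v ⬝ᵥ v = 1)
    (hx : star v ⬝ᵥ x = 0) : pureTangent v x *ᵥ v = x := by
  have hx' : star x ⬝ᵥ v = 0 := by rw [Matrix.star_dotProduct, hx, star_zero]
  rw [pureTangent, Matrix.add_mulVec, Matrix.vecMulVec_mulVec, Matrix.vecMulVec_mulVec, hv, hx']
  simp

theorem pureTangent_isHermitian {a : Type*} (v x : a → ℂ) : (pureTangent v x).IsHermitian := by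
  rw [Matrix.IsHermitian, pureTangent, Matrix.conjTranspose_add, Matrix.conjTranspose_vecMulVec,
    Matrix.conjTranspose_vecMulVec, star_star, star_star, add_comm]

theorem star_dotProduct_mulVec_of_isHermitian {a : Type*} [Fintype a] {K : Matrix a a ℂ}
    (hK : K.IsHermitian) (v w : a → ℂ) : star v ⬝ᵥ (K *ᵥ w) = star (K *ᵥ v) ⬝ᵥ w := by
  rw [Matrix.star_mulVec, hK.eq, Matrix.dotProduct_mulVec]

theorem trace_pureState_mul {a : Type*} [Fintype a] (v : a → ℂ) (K : Matrix a a ℂ) :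
    (pureState v * K).trace = star v ⬝ᵥ (K *ᵥ v) := by
  rw [pureState, Matrix.vecMulVec_mul, Matrix.trace_vecMulVec, dotProduct_comm,
    Matrix.dotProduct_mulVec]

theorem trace_mul_pureTangent {a : Type*} [Fintype a] {K : Matrix a a ℂ} (hK : K.IsHermitian)
    (v x : a → ℂ) :
    (K * pureTangent v x).trace = star (K *ᵥ v) ⬝ᵥ x + star x ⬝ᵥ (K *ᵥ v) := by
  rw [pureTangent, Matrix.mul_add, Matrix.trace_add, Matrix.mul_vecMulVec, Matrix.mul_vecMulVec,
    Matrix.trace_vecMulVec, Matrix.trace_vecMulVec, dotProduct_comm,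
    star_dotProduct_mulVec_of_isHermitian hK, dotProduct_comm (K *ᵥ v)]

/-- A multiple of the identity may be subtracted from the generator, which makes the velocity
orthogonal to `v` when it is the expectation value. -/
theorem smul_lie_pureState {a : Type*} [Fintype a] {K : Matrix a a ℂ} (hK : K.IsHermitian)
    {z : ℂ} (hz : star z = -z) (c : ℝ) (v : a → ℂ) :
    z • ⁅K, pureState v⁆ = pureTangent v (z • (K *ᵥ v - (c : ℂ) • v)) := by
  have h : Matrix.vecMulVec v (star v) * K = Matrix.vecMulVec v (star (K *ᵥ v)) := by
    rw [Matrix.vecMulVec_mul, Matrix.star_mulVec, hK.eq]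
  rw [Ring.lie_def, pureState, pureTangent, Matrix.mul_vecMulVec, h]
  ext i j
  simp only [Matrix.smul_apply, Matrix.sub_apply, Matrix.add_apply, Matrix.vecMulVec_apply,
    Pi.smul_apply, Pi.sub_apply, Pi.star_apply, smul_eq_mul, star_mul', star_sub, hz,
    Complex.star_def, Complex.conj_ofReal]
  ring

theorem star_dotProduct_sub_smul {a : Type*} [Fintype a] {v y : a → ℂ} {c : ℂ}
    (hv : star v ⬝ᵥ v = 1) (hy : star v ⬝ᵥ y = c) (z : ℂ) :
    star v ⬝ᵥ (z • (y - c • v)) = 0 := by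
  rw [dotProduct_smul, dotProduct_sub, dotProduct_smul, hv, hy]
  simp

theorem hasFisherInfo_pureState {a : Type*} [Fintype a] [DecidableEq a] {v x : a → ℂ}
    (hv : star v ⬝ᵥ v = 1) (hx : star v ⬝ᵥ x = 0) {s : ℝ} (hs : star x ⬝ᵥ x = (s : ℂ)) :
    HasFisherInfo (pureState v) (pureTangent v x) (4 * s) := by
  have hx' : star x ⬝ᵥ v = 0 := by rw [Matrix.star_dotProduct, hx, star_zero]
  have h1 : pureState v * pureTangent v x = Matrix.vecMulVec v (star x) := by
    rw [pureState, pureTangent, Matrix.mul_add, Matrix.vecMulVec_mul_vecMulVec,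
      Matrix.vecMulVec_mul_vecMulVec, hv, hx]
    simp
  have h2 : pureTangent v x * pureState v = Matrix.vecMulVec x (star v) := by
    rw [pureState, pureTangent, Matrix.add_mul, Matrix.vecMulVec_mul_vecMulVec,
      Matrix.vecMulVec_mul_vecMulVec, hv, hx']
    simp
  have hSLD : IsSLD (pureState v) (pureTangent v x) ((2 : ℂ) • pureTangent v x) := by
    refine ⟨?_, ?_⟩
    · rw [Matrix.IsHermitian, Matrix.conjTranspose_smul, (pureTangent_isHermitian v x).eq]
      simp
    · rw [mul_smul_comm, smul_mul_assoc, h1, h2, ← smul_add, smul_smul, add_comm]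
      norm_num [pureTangent]
  refine hSLD.hasFisherInfo ?_
  rw [hSLD.trace_mul_sq, mul_smul_comm, Matrix.trace_smul,
    trace_mul_pureTangent (pureTangent_isHermitian v x), pureTangent_mulVec hv hx, hs]
  push_cast
  rw [smul_eq_mul]
  ring

theorem meanSquareError_pureState {a : Type*} [Fintype a] [DecidableEq a] (v : a → ℂ) (c : ℝ)
    {T : Matrix a a ℂ} (hT : T.IsHermitian) :
    meanSquareError (pureState v) c T =
      (star (T *ᵥ v - (c : ℂ) • v) ⬝ᵥ (T *ᵥ v - (c : ℂ) • v)).re := by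
  have hH : (T - (c : ℂ) • (1 : Matrix a a ℂ)).IsHermitian := by
    rw [Matrix.IsHermitian, Matrix.conjTranspose_sub, hT.eq, Matrix.conjTranspose_smul]
    simp
  rw [meanSquareError, expectation, trace_pureState_mul, pow_two, ← Matrix.mulVec_mulVec,
    star_dotProduct_mulVec_of_isHermitian hH, Matrix.sub_mulVec, Matrix.smul_mulVec,
    Matrix.one_mulVec]

/-- The equality case of the Cauchy–Schwarz inequality: on `v`, an optimal sensing observable
acts like `c + pureTangent v x / (2 s)`. -/
theorem IsOptimalLocalSensing.mulVec_sub {a : Type*} [Fintype a] [DecidableEq a] {v x : a → ℂ}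
    {c s : ℝ} {T : Matrix a a ℂ} (h : IsOptimalLocalSensing (pureState v) (pureTangent v x) c T)
    (hv : star v ⬝ᵥ v = 1) (hx : star v ⬝ᵥ x = 0) (hs : star x ⬝ᵥ x = (s : ℂ)) (hs0 : 0 < s) :
    T *ᵥ v - (c : ℂ) • v = ((1 / (2 * s) : ℝ) : ℂ) • x := by
  have hx' : star x ⬝ᵥ v = 0 := by rw [Matrix.star_dotProduct, hx, star_zero]
  obtain ⟨⟨hT, -, htr⟩, hmin⟩ := h
  set r : ℝ := 1 / (2 * s) with hr
  have hrs : r * s = 1 / 2 := by rw [hr]; field_simp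
  -- the competitor that attains the Cauchy–Schwarz bound `1 / (4 s)`
  set T₀ : Matrix a a ℂ := (c : ℂ) • (1 : Matrix a a ℂ) + (r : ℂ) • pureTangent v x with hT₀
  have hT₀h : T₀.IsHermitian := by
    rw [Matrix.IsHermitian, hT₀, Matrix.conjTranspose_add, Matrix.conjTranspose_smul,
      Matrix.conjTranspose_smul, (pureTangent_isHermitian v x).eq]
    simp
  have hT₀v : T₀ *ᵥ v = (c : ℂ) • v + (r : ℂ) • x := by
    rw [hT₀, Matrix.add_mulVec, Matrix.smul_mulVec, Matrix.smul_mulVec, Matrix.one_mulVec,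
      pureTangent_mulVec hv hx]
  have hsens : IsLocalSensing (pureState v) (pureTangent v x) c T₀ := by
    refine ⟨hT₀h, ?_, ?_⟩
    · rw [trace_pureState_mul, hT₀v, dotProduct_add, dotProduct_smul, dotProduct_smul, hv, hx]
      simp
    · rw [trace_mul_pureTangent hT₀h, hT₀v, star_add, star_smul, star_smul, add_dotProduct,
        dotProduct_add, smul_dotProduct, smul_dotProduct, dotProduct_smul, dotProduct_smul, hs, hx,
        hx']
      simp only [Complex.star_def, Complex.conj_ofReal, smul_eq_mul]
      rw [← Complex.ofReal_mul, hrs]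
      norm_num
  have hle := hmin T₀ hsens
  rw [meanSquareError_pureState v c hT, meanSquareError_pureState v c hT₀h, hT₀v,
    add_sub_cancel_left] at hle
  rw [trace_mul_pureTangent hT] at htr
  set y := T *ᵥ v - (c : ℂ) • v with hy
  have hcross : star y ⬝ᵥ x + star x ⬝ᵥ y = 1 := by
    rw [← htr, hy, star_sub, star_smul, sub_dotProduct, dotProduct_sub, smul_dotProduct,
      dotProduct_smul, hx, hx']
    simp
  have hx0 : (star ((r : ℂ) • x) ⬝ᵥ ((r : ℂ) • x)).re = r / 2 := by
    rw [star_smul, smul_dotProduct, dotProduct_smul, hs]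
    simp only [Complex.star_def, Complex.conj_ofReal, smul_eq_mul]
    rw [← Complex.ofReal_mul, ← Complex.ofReal_mul, Complex.ofReal_re, hrs]
    ring
  have hdiff : star (y - (r : ℂ) • x) ⬝ᵥ (y - (r : ℂ) • x) =
      star y ⬝ᵥ y - (r : ℂ) * (star y ⬝ᵥ x + star x ⬝ᵥ y) +
        star ((r : ℂ) • x) ⬝ᵥ ((r : ℂ) • x) := by
    simp only [star_sub, star_smul, sub_dotProduct, dotProduct_sub, smul_dotProduct,
      dotProduct_smul, Complex.star_def, Complex.conj_ofReal, smul_eq_mul]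
    ring
  have hnn : 0 ≤ star (y - (r : ℂ) • x) ⬝ᵥ (y - (r : ℂ) • x) := dotProduct_star_self_nonneg _
  have hre : (star (y - (r : ℂ) • x) ⬝ᵥ (y - (r : ℂ) • x)).re ≤ 0 := by
    rw [hx0] at hle
    rw [hdiff, hcross, Complex.add_re, Complex.sub_re, hx0, mul_one, Complex.ofReal_re]
    linarith
  have hz : star (y - (r : ℂ) • x) ⬝ᵥ (y - (r : ℂ) • x) = 0 :=
    le_antisymm (Complex.le_def.2 ⟨hre, (Complex.le_def.1 hnn).2.symm⟩) hnn
  exact sub_eq_zero.1 (dotProduct_star_self_eq_zero.1 hz)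

/-! ### Marginals of the dilated state -/

/-- The vector `V v` of `B ⊗ E`, as a matrix with rows in `B` and columns in `E`. For a unit vector
`v` and `M = bipartiteMatrix V v`, the marginals of `V v` are `M * Mᴴ` and `(Mᴴ * M)ᵀ`. -/
def bipartiteMatrix {a b e : Type*} [Fintype a] (V : Matrix (b × e) a ℂ) (v : a → ℂ) :
    Matrix b e ℂ :=
  Matrix.of fun i k => (V *ᵥ v) (i, k)

theorem bipartiteMatrix_smul {a b e : Type*} [Fintype a] (V : Matrix (b × e) a ℂ) (c : ℂ)
    (v : a → ℂ) : bipartiteMatrix V (c • v) = c • bipartiteMatrix V v := by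
  ext i k
  simp [bipartiteMatrix, Matrix.mulVec_smul]

theorem bipartiteMatrix_mulVec {a b e : Type*} [Fintype a] [Fintype e] (V : Matrix (b × e) a ℂ)
    (v : a → ℂ) (w : e → ℂ) :
    bipartiteMatrix V v *ᵥ w = (Matrix.of fun i j => ∑ k, V (i, k) j * w k) *ᵥ v := by
  ext i
  simp only [bipartiteMatrix, Matrix.mulVec, dotProduct, Matrix.of_apply, Finset.sum_mul]
  rw [Finset.sum_comm]
  exact Finset.sum_congr rfl fun j _ => Finset.sum_congr rfl fun k _ => by ring

theorem conj_vecMulVec {a c : Type*} [Fintype a] (V : Matrix c a ℂ) (x y : a → ℂ) :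
    V * Matrix.vecMulVec x (star y) * Vᴴ = Matrix.vecMulVec (V *ᵥ x) (star (V *ᵥ y)) := by
  rw [Matrix.mul_vecMulVec, Matrix.vecMulVec_mul, Matrix.star_mulVec]

theorem traceRight_conj_vecMulVec {a b e : Type*} [Fintype a] [Fintype e]
    (V : Matrix (b × e) a ℂ) (x y : a → ℂ) :
    traceRight (V * Matrix.vecMulVec x (star y) * Vᴴ) =
      bipartiteMatrix V x * (bipartiteMatrix V y)ᴴ := by
  rw [conj_vecMulVec]
  ext i j
  simp [traceRight, bipartiteMatrix, Matrix.mul_apply, Matrix.vecMulVec_apply]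

theorem traceLeft_conj_vecMulVec {a b e : Type*} [Fintype a] [Fintype b]
    (V : Matrix (b × e) a ℂ) (x y : a → ℂ) :
    traceLeft (V * Matrix.vecMulVec x (star y) * Vᴴ) =
      ((bipartiteMatrix V y)ᴴ * bipartiteMatrix V x)ᵀ := by
  rw [conj_vecMulVec]
  ext i j
  simp [traceLeft, bipartiteMatrix, Matrix.mul_apply, Matrix.vecMulVec_apply, mul_comm]

theorem trace_conjTranspose_bipartiteMatrix_mul_self {a b e : Type*} [Fintype a] [DecidableEq a]
    [Fintype b] [Fintype e] {V : Matrix (b × e) a ℂ} (hV : Vᴴ * V = 1) (x : a → ℂ) :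
    ((bipartiteMatrix V x)ᴴ * bipartiteMatrix V x).trace = star x ⬝ᵥ x := by
  have h : star (V *ᵥ x) ⬝ᵥ (V *ᵥ x) = star x ⬝ᵥ x := by
    rw [Matrix.star_mulVec, ← Matrix.dotProduct_mulVec, Matrix.mulVec_mulVec, hV, Matrix.one_mulVec]
  rw [← h, dotProduct, Fintype.sum_prod_type_right]
  simp [Matrix.trace, Matrix.mul_apply, bipartiteMatrix]

/-! ### Differentiable families of matrices -/

theorem hasDerivAt_matrix_iff_tendsto_slope {b : Type*} [Fintype b] {ρ : ℝ → Matrix b b ℂ}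
    {D : Matrix b b ℂ} {t : ℝ} :
    HasDerivAt ρ D t ↔ Filter.Tendsto (slope ρ t) (𝓝[≠] t) (𝓝 D) := by
  let _ : NormedAddCommGroup (Matrix b b ℂ) := Matrix.normedAddCommGroup
  let _ : NormedSpace ℝ (Matrix b b ℂ) := Matrix.normedSpace
  exact hasDerivAt_iff_tendsto_slope

theorem continuousAt_of_hasDerivAt_matrix {b : Type*} [Fintype b] {ρ : ℝ → Matrix b b ℂ}
    {D : Matrix b b ℂ} {t : ℝ} (h : HasDerivAt ρ D t) : ContinuousAt ρ t := by
  let _ : NormedAddCommGroup (Matrix b b ℂ) := Matrix.normedAddCommGroup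
  let _ : NormedSpace ℝ (Matrix b b ℂ) := Matrix.normedSpace
  exact HasDerivAt.continuousAt h

theorem hasDerivAt_linearMap_comp {a b : Type*} [Fintype a] [Fintype b]
    (L : Matrix a a ℂ →ₗ[ℂ] Matrix b b ℂ) {ρ : ℝ → Matrix a a ℂ} {D : Matrix a a ℂ} {t : ℝ}
    (h : HasDerivAt ρ D t) : HasDerivAt (fun s => L (ρ s)) (L D) t := by
  rw [hasDerivAt_matrix_iff_tendsto_slope] at h ⊢
  have hL : Continuous L := L.continuous_of_finiteDimensional
  refine ((hL.tendsto D).comp h).congr fun s => ?_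
  simp only [Function.comp_apply, slope, vsub_eq_sub]
  rw [← map_sub, ← Complex.coe_smul, ← Complex.coe_smul, map_smul]

theorem IsEigenvalueFamilyNear.eventually_nonneg {b : Type*} [Fintype b] [DecidableEq b]
    {ρ : ℝ → Matrix b b ℂ} {t₀ : ℝ} {p : b → ℝ → ℝ} (hp : IsEigenvalueFamilyNear ρ t₀ p)
    (hρ : ∀ t, (ρ t).PosSemidef) (k : b) : ∀ᶠ t in 𝓝 t₀, 0 ≤ p k t := by
  filter_upwards [hp] with t ht
  obtain ⟨U, -, hU⟩ := exists_unitary_conj_eq_diagonal (hρ t).1 ht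
  have h := ((hρ t).conjTranspose_mul_mul_same U).diag_nonneg (i := k)
  rw [hU, Matrix.diagonal_apply_eq] at h
  exact_mod_cast h

/-! ### Fisher informations of the channel outputs -/

theorem posSemidef_sub_of_norm_le {b e : Type*} [Fintype b] [Fintype e] (M : Matrix b e ℂ) {c : ℂ}
    (hc : ‖c‖ ≤ 1) : (M * Mᴴ - (c • M) * (c • M)ᴴ).PosSemidef := by
  have h : M * Mᴴ - (c • M) * (c • M)ᴴ = ((1 - ‖c‖ ^ 2 : ℝ) : ℂ) • (M * Mᴴ) := by
    rw [Matrix.conjTranspose_smul, Matrix.smul_mul, Matrix.mul_smul, smul_smul, Complex.star_def,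
      Complex.mul_conj, Complex.normSq_eq_norm_sq]
    push_cast
    rw [sub_smul, one_smul]
  rw [h]
  refine (Matrix.posSemidef_self_mul_conjTranspose M).smul ?_
  have : ‖c‖ ^ 2 ≤ 1 := pow_le_one₀ (norm_nonneg c) hc
  exact_mod_cast sub_nonneg.2 this

theorem norm_star_dotProduct_le_one {a : Type*} [Fintype a] {v w : a → ℂ}
    (hv : star v ⬝ᵥ v = 1) (hw : star w ⬝ᵥ w = 1) : ‖star v ⬝ᵥ w‖ ≤ 1 := by
  have h0 : ∀ {y : a → ℂ}, star y ⬝ᵥ y = 1 → ‖WithLp.toLp 2 y‖ = 1 := by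
    intro y hy
    have := inner_self_eq_norm_sq_to_K (𝕜 := ℂ) (WithLp.toLp 2 y)
    rw [EuclideanSpace.inner_toLp_toLp, dotProduct_comm, hy] at this
    have h2 : ‖WithLp.toLp 2 y‖ ^ 2 = 1 := Complex.ofReal_injective (by simpa using this.symm)
    exact (pow_eq_one_iff_of_nonneg (norm_nonneg _) two_ne_zero).1 h2
  have := norm_inner_le_norm (𝕜 := ℂ) (WithLp.toLp 2 v) (WithLp.toLp 2 w)
  rwa [h0 hv, h0 hw, one_mul, EuclideanSpace.inner_toLp_toLp, dotProduct_comm] at this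

/-- If no eigenvalue of Bob's state becomes non-zero at second order, then the velocity of the
dilated vector has no component between the kernels of the two marginals. The overlap
`pureState (ψ t) *ᵥ ψ t₀` removes the undetermined phases of `ψ t`: it is a sub-normalised
multiple of `ψ t` and is differentiable at `t₀`. -/
theorem bipartiteMatrix_velocity_eq_zero {a b e : Type*} [Fintype a] [Fintype b]
    [DecidableEq b] [Fintype e] {N : Matrix a a ℂ →ₗ[ℂ] Matrix b b ℂ} {V : Matrix (b × e) a ℂ}
    (hNV : ∀ X, N X = traceRight (V * X * Vᴴ)) {φ : ℝ → a → ℂ} (hφ : ∀ t, star (φ t) ⬝ᵥ φ t = 1)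
    {t₀ : ℝ} {x : a → ℂ} (hx : star (φ t₀) ⬝ᵥ x = 0)
    (hd : HasDerivAt (fun t => pureState (φ t)) (pureTangent (φ t₀) x) t₀) {p : b → ℝ → ℝ}
    (hp : IsEigenvalueFamilyNear (fun t => N (pureState (φ t))) t₀ p)
    (hrank : ∀ k, p k t₀ = 0 → HasSecondDerivAt (p k) 0 t₀) {u : b → ℂ} {w : e → ℂ}
    (hu : (bipartiteMatrix V (φ t₀))ᴴ *ᵥ u = 0) (hw : bipartiteMatrix V (φ t₀) *ᵥ w = 0) :
    star u ⬝ᵥ (bipartiteMatrix V x *ᵥ w) = 0 := by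
  have hN : ∀ t, N (pureState (φ t)) =
      bipartiteMatrix V (φ t) * (bipartiteMatrix V (φ t))ᴴ := fun t => by
    rw [hNV, pureState, traceRight_conj_vecMulVec]
  have hpsd : ∀ t, (N (pureState (φ t))).PosSemidef := fun t => by
    rw [hN]
    exact Matrix.posSemidef_self_mul_conjTranspose _
  refine dotProduct_eq_zero_of_isLittleO (ρ := fun t => N (pureState (φ t)))
    (G := fun t => bipartiteMatrix V (pureState (φ t) *ᵥ φ t₀)) (p := p) (w := w)
    (fun t => (hpsd t).1) ?_ ?_ hp ?_ ?_ ?_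
  · exact (continuousAt_of_hasDerivAt_matrix (hasDerivAt_linearMap_comp N hd)).mono_left
      nhdsWithin_le_nhds
  · intro t
    rw [hN, pureState_mulVec, bipartiteMatrix_smul]
    exact posSemidef_sub_of_norm_le _ (norm_star_dotProduct_le_one (hφ t) (hφ t₀))
  · exact fun k hk => (hrank k hk).isLittleO_sq hk (hp.eventually_nonneg hpsd k)
  · rw [hN, ← Matrix.mulVec_mulVec, hu, Matrix.mulVec_zero]
  · have hs := hasDerivAt_matrix_iff_tendsto_slope.1 hd
    have h1 := tendsto_mulVec (tendsto_const_nhds (x := Matrix.of fun i j => ∑ k, V (i, k) j * w k))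
      (tendsto_mulVec hs (tendsto_const_nhds (x := φ t₀)))
    rw [pureTangent_mulVec (hφ t₀) hx, ← bipartiteMatrix_mulVec] at h1
    refine h1.congr fun t => ?_
    rw [slope, vsub_eq_sub, ← Complex.coe_smul, Matrix.smul_mulVec, Matrix.mulVec_smul,
      Matrix.sub_mulVec, Matrix.mulVec_sub, pureState_mulVec (φ t₀), hφ t₀, one_smul,
      ← bipartiteMatrix_mulVec V (φ t₀), hw, sub_zero, ← bipartiteMatrix_mulVec,
      Complex.ofReal_inv]

/-- The sum of Bob's and Eve's Fisher informations along `x` and `r i x`, rescaled by `r`. -/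
theorem exists_hasFisherInfo_marginals {a b e : Type*} [Fintype a] [DecidableEq a] [Fintype b]
    [DecidableEq b] [Fintype e] [DecidableEq e] {N : Matrix a a ℂ →ₗ[ℂ] Matrix b b ℂ}
    {Nc : Matrix a a ℂ →ₗ[ℂ] Matrix e e ℂ} {V : Matrix (b × e) a ℂ} (hV : Vᴴ * V = 1)
    (hNV : ∀ X, N X = traceRight (V * X * Vᴴ)) (hNc : ∀ X, Nc X = traceLeft (V * X * Vᴴ))
    {v x : a → ℂ} {s : ℝ} (hs : star x ⬝ᵥ x = (s : ℂ)) (r : ℝ)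
    (hX : ∀ u w, (bipartiteMatrix V v)ᴴ *ᵥ u = 0 → bipartiteMatrix V v *ᵥ w = 0 →
      star u ⬝ᵥ (bipartiteMatrix V x *ᵥ w) = 0) :
    ∃ F G : ℝ, HasFisherInfo (N (pureState v)) (N (pureTangent v x)) F ∧
      HasFisherInfo (Nc (pureState v)) (Nc (pureTangent v (((r : ℂ) * Complex.I) • x)))
        (r ^ 2 * G) ∧ F + G = 4 * s := by
  obtain ⟨F, G, hF, hG, hFG⟩ :=
    exists_hasFisherInfo_add_eq (bipartiteMatrix V v) (bipartiteMatrix V x) hX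
  refine ⟨F, G, ?_, ?_, ?_⟩
  · rw [pureTangent, map_add, pureState, hNV, hNV, hNV, traceRight_conj_vecMulVec,
      traceRight_conj_vecMulVec, traceRight_conj_vecMulVec]
    exact hF
  · rw [pureTangent, map_add, pureState, hNc, hNc, hNc, traceLeft_conj_vecMulVec,
      traceLeft_conj_vecMulVec, traceLeft_conj_vecMulVec, ← Matrix.transpose_add,
      bipartiteMatrix_smul]
    convert (hG.smul r).transpose using 2
    rw [Matrix.conjTranspose_smul, Matrix.smul_mul, Matrix.mul_smul, star_mul', Complex.star_def,
      Complex.conj_ofReal, Complex.conj_I]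
    module
  · rw [trace_conjTranspose_bipartiteMatrix_mul_self hV, hs] at hFG
    exact_mod_cast hFG

theorem mulVec_sub_ne_zero_of_variance_ne_zero {a : Type*} [Fintype a] [DecidableEq a] {v : a → ℂ}
    (hv : star v ⬝ᵥ v = 1) {H : Matrix a a ℂ} {c : ℝ} (h : variance (pureState v) H ≠ 0) :
    H *ᵥ v - (c : ℂ) • v ≠ 0 := by
  intro h0
  refine h ?_
  rw [variance, expectation, expectation, trace_pureState_mul, trace_pureState_mul, pow_two,
    ← Matrix.mulVec_mulVec, sub_eq_zero.1 h0, Matrix.mulVec_smul, sub_eq_zero.1 h0,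
    dotProduct_smul, dotProduct_smul, hv]
  simp [pow_two]

end BipartiteUncertainty

/-! ### The uncertainty relation -/

theorem theoremz {a b e : Type*} [Fintype a] [DecidableEq a] [Fintype b] [DecidableEq b]
    [Fintype e] [DecidableEq e]
    -- the channel from Alice to Bob, and a complementary channel from Alice to Eve
    (N : Matrix a a ℂ →ₗ[ℂ] Matrix b b ℂ) (Nc : Matrix a a ℂ →ₗ[ℂ] Matrix e e ℂ)
    (hN : IsQuantumChannel N)
    (hNc : IsComplementaryChannel N Nc)
    -- the family of unit vectors `ψ t η`, the Hamiltonian `H` and the observable `T`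
    (ψ : ℝ → ℝ → a → ℂ) (hψ : ∀ t η, star (ψ t η) ⬝ᵥ ψ t η = 1)
    (H T : Matrix a a ℂ) (hH : H.IsHermitian) (t₀ η₀ : ℝ)
    (hη₀ : η₀ = expectation (pureState (ψ t₀ η₀)) H)
    -- the probe is not stationary under `H`
    (hvar : variance (pureState (ψ t₀ η₀)) H ≠ 0)
    -- evolution in `t` is generated by `H`
    (ht : HasDerivAt (fun t => pureState (ψ t η₀))
      ((-Complex.I) • ⁅H, pureState (ψ t₀ η₀)⁆) t₀)
    -- `T` is an optimal local sensing observable for `t`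
    (hT : IsOptimalLocalSensing (pureState (ψ t₀ η₀))
      ((-Complex.I) • ⁅H, pureState (ψ t₀ η₀)⁆) t₀ T)
    -- evolution in `η` is generated by `-T`
    (hη : HasDerivAt (fun η => pureState (ψ t₀ η))
      (Complex.I • ⁅T, pureState (ψ t₀ η₀)⁆) η₀)
    -- no change of rank of Bob's state at `t₀`
    (p : b → ℝ → ℝ)
    (hp : IsEigenvalueFamilyNear
      (fun t => N (pureState (ψ t η₀))) t₀ p)
    (hrank : ∀ k, p k t₀ = 0 → HasSecondDerivAt (p k) 0 t₀) :
    ∃ FAliceT FBobT FAliceη FEveη : ℝ,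
      HasFisherInfoAt (fun t => pureState (ψ t η₀)) t₀ FAliceT ∧
      HasFisherInfoAt (fun t => N (pureState (ψ t η₀))) t₀ FBobT ∧
      HasFisherInfoAt (fun η => pureState (ψ t₀ η)) η₀ FAliceη ∧
      HasFisherInfoAt (fun η => Nc (pureState (ψ t₀ η))) η₀ FEveη ∧
      0 < FAliceT ∧ 0 < FAliceη ∧
      FBobT / FAliceT + FEveη / FAliceη = 1 := by
  obtain ⟨V, hV, hNV, hNcV⟩ := hNc
  set φ : a → ℂ := ψ t₀ η₀ with hφdef
  have hφ : star φ ⬝ᵥ φ = 1 := hψ t₀ η₀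
  have hHφ : star φ ⬝ᵥ (H *ᵥ φ) = (η₀ : ℂ) := by
    have him : star (star φ ⬝ᵥ (H *ᵥ φ)) = star φ ⬝ᵥ (H *ᵥ φ) := by
      rw [← Matrix.star_dotProduct, ← star_dotProduct_mulVec_of_isHermitian hH]
    rw [hη₀, expectation, trace_pureState_mul]
    exact (Complex.conj_eq_iff_re.1 him).symm
  -- the velocities of the state vector in the two parameters
  set ξ : a → ℂ := (-Complex.I) • (H *ᵥ φ - (η₀ : ℂ) • φ) with hξdef
  have hξ : star φ ⬝ᵥ ξ = 0 := star_dotProduct_sub_smul hφ hHφ _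
  have hDt : (-Complex.I) • ⁅H, pureState φ⁆ = pureTangent φ ξ :=
    smul_lie_pureState hH (by simp) η₀ φ
  rw [hDt] at ht hT
  have hξ0 : ξ ≠ 0 :=
    smul_ne_zero (neg_ne_zero.2 Complex.I_ne_zero)
      (mulVec_sub_ne_zero_of_variance_ne_zero hφ hvar)
  obtain ⟨s, hs0, hs⟩ : ∃ s : ℝ, 0 < s ∧ star ξ ⬝ᵥ ξ = (s : ℂ) := by
    have h := dotProduct_star_self_nonneg ξ
    have hne : star ξ ⬝ᵥ ξ ≠ 0 := fun h => hξ0 (dotProduct_star_self_eq_zero.1 h)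
    have hre : star ξ ⬝ᵥ ξ = ((star ξ ⬝ᵥ ξ).re : ℂ) :=
      Complex.eq_re_of_ofReal_le (r := 0) (by simp)
    refine ⟨(star ξ ⬝ᵥ ξ).re, lt_of_le_of_ne (Complex.le_def.1 h).1 fun h0 => hne ?_, hre⟩
    rw [hre, ← h0]
    simp
  set r : ℝ := 1 / (2 * s) with hr
  have hTφ : T *ᵥ φ - (t₀ : ℂ) • φ = (r : ℂ) • ξ := hT.mulVec_sub hφ hξ hs hs0
  have hDη : Complex.I • ⁅T, pureState φ⁆ = pureTangent φ (((r : ℂ) * Complex.I) • ξ) := by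
    rw [smul_lie_pureState hT.1.1 (by simp) t₀ φ, hTφ, smul_smul, mul_comm]
  rw [hDη] at hη
  have hζ : star φ ⬝ᵥ (((r : ℂ) * Complex.I) • ξ) = 0 := by
    rw [dotProduct_smul, hξ, smul_zero]
  have hζs : star (((r : ℂ) * Complex.I) • ξ) ⬝ᵥ (((r : ℂ) * Complex.I) • ξ) =
      ((r ^ 2 * s : ℝ) : ℂ) := by
    rw [star_smul, smul_dotProduct, dotProduct_smul, hs, star_mul', Complex.star_def,
      Complex.conj_ofReal, Complex.conj_I]
    simp only [smul_eq_mul]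
    push_cast
    linear_combination (-(r : ℂ) ^ 2 * s) * Complex.I_mul_I
  obtain ⟨F, G, hF, hG, hFG⟩ := exists_hasFisherInfo_marginals hV hNV hNcV hs r fun u w hu hw =>
    bipartiteMatrix_velocity_eq_zero hNV (φ := fun t => ψ t η₀) (fun t => hψ t η₀) hξ ht hp hrank
      hu hw
  refine ⟨4 * s, F, 4 * (r ^ 2 * s), r ^ 2 * G,
    ⟨_, ht, hasFisherInfo_pureState hφ hξ hs⟩, ⟨_, hasDerivAt_linearMap_comp N ht, hF⟩,
    ⟨_, hη, hasFisherInfo_pureState hφ hζ hζs⟩, ⟨_, hasDerivAt_linearMap_comp Nc hη, hG⟩,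
    by positivity, by positivity, ?_⟩
  have hr0 : r ≠ 0 := by positivity
  have : F = 4 * s - G := by linarith
  rw [this]
  field_simp
  ring
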